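/- Let $\mathrm{Out}$ be the category of finite groups and conjugacy classes of surjective homomorphisms. A $\mathbb{Q}[\mathrm{Out}^{op}]$-module is a functor $\mathrm{Out}^{op}\to \mathbb{Q}\text{-Mod}$. For a finite group $G$ let $L(G)$ be the simplicial set whose $k$-simplices are the chains $H_0\le\dots\le H_k$ of subgroups of $G$ (the nerve of the subgroup lattice), and for $n\in\mathbb{N}\cup\{\infty\}$ let $L(G)_n\subseteq L(G)$ consist of the chains of total index $[H_k:H_0]\le n$. Let $\widetilde L(G)_n$ be the quotient of $L(G)_n$ by the subcomplex of chains with $H_k\ne G$; $G$ acts on it by conjugation. A surjection $\psi:G\to K$ sends $[H_0\le\dots\le H_k]$ to $[\psi^{-1}(H_0)\le\dots\le\psi^{-1}(H_k)]$, so that $G\mapsto \widetilde L(G)_n/G$ is a functor from $\mathrm{Out}^{op}$ to pointed simplicial sets. Let $\mathcal{C}\widetilde L_n$ be the chain complex of $\mathbb{Q}[\mathrm{Out}^{op}]$-modules of normalized rational chains (modulo the base point) on this functor, and write $\mathcal{C}\widetilde L=\mathcal{C}\widetilde L_\infty$. Call a chain $H_0\lneq\dots\lneq H_k$ of finite groups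 simple if $H_0$ contains no non-trivial normal subgroup of $H_k$. Let $\mathrm{Out}(H_0\lneq\dots\lneq H_k)$ be the group of conjugacy classes of automorphisms of $H_k$ which map the chain to an $H_k$-conjugate of itself; it acts on the representable module $\mathbb{Q}[\mathrm{Out}(-,H_k)]$ by postcomposition. Proposition. Let $n\in\mathbb{N}\cup\{\infty\}$ and $k\ge 0$. (1) $(\mathcal{C}\widetilde L_n)_k$ is a projective $\mathbb{Q}[\mathrm{Out}^{op}]$-module. (2) The maps sending the class of $\psi:G\twoheadrightarrow H_k$ to the class of the chain $\psi^{-1}(H_0)\lneq\dots\lneq\psi^{-1}(H_k)=G$ induce an isomorphism of $\mathbb{Q}[\mathrm{Out}^{op}]$-modules \[ \bigoplus_{[H_0\lneq\dots\lneq H_k]} \mathbb{Q}[\mathrm{Out}(-,H_k)]/\mathrm{Out}(H_0\lneq\dots\lneq H_k)\;\cong\;(\mathcal{C}\widetilde L_n)_k, \] where the sum runs over representatives of the isomorphism classes of simple chains $H_0\lneq\dots\lneq H_k$ with $[H_k:H_0]\le n$, and the quotient denotes the orbits (coinvariants) of the action. (3) $\mathcal{C}\widetilde L$ is a projective resolution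 of the $\mathbb{Q}[\mathrm{Out}^{op}]$-module that sends the trivial group to $\mathbb{Q}$ and all other finite groups to $0$. -/

import Mathlib

open CategoryTheory Opposite Limits Simplicial

noncomputable section

/-! ### The category `Out` and its rational modules -/

/-- The objects of the category `Out`: finite groups. -/
structure OutCat where
  of ::
  carrier : Type
  [group : Group carrier]
  [finite : Finite carrier]

namespace OutCat

instance : CoeSort OutCat Type := ⟨OutCat.carrier⟩

instance (G : OutCat) : Group G := G.group

instance (G : OutCat) : Finite G := G.finite

/-- Surjective group homomorphisms. -/
abbrev Epim (G K : OutCat) : Type := {f : G →* K // Function.Surjective f}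

/-- Two surjective homomorphisms are conjugate if they differ by an inner automorphism of the
target. -/
def conjSetoid (G K : OutCat) : Setoid (Epim G K) where
  r f g := ∃ k : K, ∀ x, g.1 x = k * f.1 x * k⁻¹
  iseqv :=
    { refl := fun f => ⟨1, by simp⟩
      symm := by
        rintro f g ⟨k, h⟩
        exact ⟨k⁻¹, fun x => by rw [h]; group⟩
      trans := by
        rintro f g l ⟨k, h⟩ ⟨k', h'⟩
        exact ⟨k' * k, fun x => by rw [h', h]; group⟩ }

/-- Morphisms of `Out`: conjugacy classes of surjective group homomorphisms. -/
def Hom (G K : OutCat) : Type := Quotient (conjSetoid G K)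

/-- The conjugacy class of a surjective homomorphism. -/
def Hom.mk {G K : OutCat} (f : Epim G K) : Hom G K := Quotient.mk (conjSetoid G K) f

/-- Composition of conjugacy classes. -/
def Hom.comp {G K M : OutCat} : Hom G K → Hom K M → Hom G M :=
  Quotient.map₂ (sa := conjSetoid G K) (sb := conjSetoid K M) (sc := conjSetoid G M)
    (fun f g => ⟨g.1.comp f.1, g.2.comp f.2⟩) (by
      rintro f f' ⟨k, h⟩ g g' ⟨m, h'⟩
      refine ⟨m * g.1 k, fun x => ?_⟩
      simp only [MonoidHom.comp_apply, h', h, map_mul, map_inv]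
      group)

instance : Category OutCat where
  Hom := Hom
  id G := Hom.mk ⟨MonoidHom.id G, Function.surjective_id⟩
  comp := Hom.comp
  id_comp f := by
    induction f using Quotient.inductionOn
    rfl
  comp_id f := by
    induction f using Quotient.inductionOn
    rfl
  assoc f g h := by
    induction f using Quotient.inductionOn
    induction g using Quotient.inductionOn
    induction h using Quotient.inductionOn
    rfl

/-- The morphism of `Out` represented by a surjective homomorphism. -/
def mkHom {G K : OutCat} (f : Epim G K) : G ⟶ K := Hom.mk f

lemma mkHom_comp {G K M : OutCat} (f : Epim G K) (g : Epim K M) :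
    mkHom f ≫ mkHom g = mkHom ⟨g.1.comp f.1, g.2.comp f.2⟩ := rfl

lemma mkHom_id (G : OutCat) : mkHom ⟨MonoidHom.id G, Function.surjective_id⟩ = 𝟙 G := rfl

lemma mkHom_surjective {G K : OutCat} (f : G ⟶ K) : ∃ g : Epim G K, mkHom g = f :=
  Quotient.exists_rep f

lemma mkHom_eq_iff {G K : OutCat} (f g : Epim G K) :
    mkHom f = mkHom g ↔ ∃ k : K, ∀ x, g.1 x = k * f.1 x * k⁻¹ :=
  Quotient.eq (r := conjSetoid G K)

end OutCat

/-- The category of `ℚ[Out^op]`-modules. -/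
abbrev OutMod : Type 1 := OutCatᵒᵖ ⥤ ModuleCat.{0} ℚ

namespace OutMod

/-- A submodule of a `ℚ[Out^op]`-module. -/
structure Sub (P : OutMod) where
  carrier (G : OutCatᵒᵖ) : Submodule ℚ (P.obj G)
  le_comap {G K : OutCatᵒᵖ} (f : G ⟶ K) : carrier G ≤ (carrier K).comap (P.map f).hom

/-- The quotient of a `ℚ[Out^op]`-module by a submodule. -/
def Sub.quotient {P : OutMod} (N : Sub P) : OutMod where
  obj G := ModuleCat.of ℚ (P.obj G ⧸ N.carrier G)
  map f := ModuleCat.ofHom (Submodule.mapQ _ _ (P.map f).hom (N.le_comap f))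
  map_id G := by
    ext : 1
    apply Submodule.linearMap_qext
    ext x
    simp
  map_comp f g := by
    ext : 1
    apply Submodule.linearMap_qext
    ext x
    simp

/-- The projection onto a quotient. -/
def Sub.proj {P : OutMod} (N : Sub P) : P ⟶ N.quotient where
  app G := ModuleCat.ofHom (Submodule.mkQ (N.carrier G))
  naturality G K f := by
    ext x
    rfl

/-- The map induced on quotients. -/
def Sub.map {P P' : OutMod} (N : Sub P) (N' : Sub P') (f : P ⟶ P')
    (h : ∀ G, N.carrier G ≤ (N'.carrier G).comap (f.app G).hom) : N.quotient ⟶ N'.quotient where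
  app G := ModuleCat.ofHom (Submodule.mapQ _ _ (f.app G).hom (h G))
  naturality G K g := by
    ext : 1
    apply Submodule.linearMap_qext
    ext x
    have := congrArg (Submodule.Quotient.mk (p := N'.carrier K))
      (ConcreteCategory.congr_hom (f.naturality g) x)
    exact this

lemma Sub.proj_map {P P' : OutMod} (N : Sub P) (N' : Sub P') (f : P ⟶ P')
    (h : ∀ G, N.carrier G ≤ (N'.carrier G).comap (f.app G).hom) :
    N.proj ≫ N.map N' f h = f ≫ N'.proj := by
  ext G x
  rfl

lemma Sub.hom_ext {P Q : OutMod} (N : Sub P) {f g : N.quotient ⟶ Q}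
    (h : N.proj ≫ f = N.proj ≫ g) : f = g := by
  ext G x
  obtain ⟨y, rfl⟩ := Submodule.mkQ_surjective (N.carrier G) x
  exact ConcreteCategory.congr_hom (congrArg (fun t => t.app G) h) y

/-- The submodule of the constant module `ℚ` which is everything at the nontrivial groups and `0` at
the trivial groups. -/
def atTrivialSub : Sub ((Functor.const OutCatᵒᵖ).obj (ModuleCat.of ℚ ℚ)) where
  carrier G := ⨆ _ : Nontrivial G.unop, ⊤
  le_comap {G K} f := by
    refine iSup_le fun hG => ?_
    obtain ⟨g, -⟩ := OutCat.mkHom_surjective f.unop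
    have hK : Nontrivial K.unop := g.2.nontrivial
    simp [hK]

/-- The `ℚ[Out^op]`-module which sends trivial groups to `ℚ` and all other finite groups to `0`. -/
def atTrivial : OutMod := atTrivialSub.quotient

end OutMod

/-! ### The subgroup lattice -/

lemma mem_map_conj_iff {G : Type} [Group G] (H : Subgroup G) (g x : G) :
    x ∈ H.map (MulAut.conj g).toMonoidHom ↔ g⁻¹ * x * g ∈ H := by
  refine Subgroup.mem_map_equiv.trans ?_
  rw [MulAut.conj_symm_apply]

/-- The `m`-simplices of `L(G)_n`: chains `H₀ ≤ ⋯ ≤ H_m` of subgroups of `G` of total index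
`[H_m : H₀] ≤ n`. -/
def LChain (n : ℕ∞) (m : SimplexCategory) (G : OutCat) : Type :=
  {c : Fin (m.len + 1) →o Subgroup G // ((c 0).relIndex (c (Fin.last _)) : ℕ∞) ≤ n}

namespace LChain

variable {n : ℕ∞} {m m' : SimplexCategory} {G K M : OutCat}

/-- Conjugation on chains: `d = g c g⁻¹` for some `g`. -/
def conjSetoid (n : ℕ∞) (m : SimplexCategory) (G : OutCat) : Setoid (LChain n m G) where
  r c d := ∃ g : G, ∀ i, d.1 i = (c.1 i).map (MulAut.conj g).toMonoidHom
  iseqv :=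
    { refl := fun c => ⟨1, fun i => by ext x; simp⟩
      symm := by
        rintro c d ⟨g, h⟩
        refine ⟨g⁻¹, fun i => ?_⟩
        ext x
        rw [h, mem_map_conj_iff, mem_map_conj_iff]
        apply iff_of_eq
        congr 1
        group
      trans := by
        rintro c d e ⟨g, h⟩ ⟨g', h'⟩
        refine ⟨g' * g, fun i => ?_⟩
        rw [h', h, Subgroup.map_map]
        ext x
        simp }

/-- The simplicial operators. -/
def pull (f : m' ⟶ m) (c : LChain n m G) : LChain n m' G :=
  ⟨c.1.comp f.toOrderHom, by
    refine le_trans ?_ c.2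
    have h1 : c.1 0 ≤ c.1 (f.toOrderHom 0) := c.1.monotone (Fin.zero_le _)
    have h2 : c.1 (f.toOrderHom (Fin.last _)) ≤ c.1 (Fin.last _) := c.1.monotone (Fin.le_last _)
    have hne : ∀ A B : Subgroup G, A.relIndex B ≠ 0 := fun A B =>
      Subgroup.index_ne_zero_of_finite
    exact_mod_cast (Subgroup.relIndex_le_of_le_left h1 (hne _ _)).trans
      (Subgroup.relIndex_le_of_le_right h2 (hne _ _))⟩

/-- Preimages of chains along surjections. -/
def comap (f : OutCat.Epim G K) (c : LChain n m K) : LChain n m G :=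
  ⟨⟨fun i => (c.1 i).comap f.1, fun _ _ h => Subgroup.comap_mono (c.1.monotone h)⟩, by
    refine le_of_eq_of_le ?_ c.2
    change (((c.1 0).comap f.1).relIndex ((c.1 (Fin.last _)).comap f.1) : ℕ∞) = _
    rw [Subgroup.relIndex_comap, Subgroup.map_comap_eq_self_of_surjective f.2]⟩

end LChain

/-- The `m`-simplices of `L(G)_n / G`. -/
def LClass (n : ℕ∞) (m : SimplexCategory) (G : OutCat) : Type :=
  Quotient (LChain.conjSetoid n m G)

namespace LClass

variable {n : ℕ∞} {m m' : SimplexCategory} {G K M : OutCat}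

/-- The conjugacy class of a chain. -/
def mk (c : LChain n m G) : LClass n m G := Quotient.mk (LChain.conjSetoid n m G) c

lemma mk_eq_iff (c d : LChain n m G) :
    mk c = mk d ↔ ∃ g : G, ∀ i, d.1 i = (c.1 i).map (MulAut.conj g).toMonoidHom :=
  Quotient.eq (r := LChain.conjSetoid n m G)

lemma mk_surjective (x : LClass n m G) : ∃ c, mk c = x := Quotient.exists_rep x

/-- The simplicial operators on conjugacy classes. -/
def pull (f : m' ⟶ m) : LClass n m G → LClass n m' G :=
  Quotient.map (sa := LChain.conjSetoid n m G) (sb := LChain.conjSetoid n m' G) (LChain.pull f) (by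
    rintro c d ⟨g, h⟩
    exact ⟨g, fun i => h _⟩)

/-- Restriction along conjugacy classes of surjections: `ψ^*[H₀ ≤ ⋯ ≤ H_m]` is
`[ψ⁻¹(H₀) ≤ ⋯ ≤ ψ⁻¹(H_m)]`. -/
def comap : (G ⟶ K) → LClass n m K → LClass n m G :=
  Quotient.map₂ (sa := OutCat.conjSetoid G K) (sb := LChain.conjSetoid n m K)
    (sc := LChain.conjSetoid n m G) LChain.comap (by
    rintro f f' ⟨k, h⟩ c d ⟨k', h'⟩
    obtain ⟨g, hg⟩ := f.2 (k⁻¹ * k')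
    refine ⟨g, fun i => ?_⟩
    change (d.1 i).comap f'.1 = ((c.1 i).comap f.1).map (MulAut.conj g).toMonoidHom
    rw [h']
    ext x
    simp only [Subgroup.mem_comap, mem_map_conj_iff, map_mul, map_inv, h, hg]
    apply iff_of_eq
    congr 1
    group)

lemma comap_mkHom_mk (f : OutCat.Epim G K) (c : LChain n m K) :
    comap (OutCat.mkHom f) (mk c) = mk (LChain.comap f c) := rfl

lemma pull_mk (f : m' ⟶ m) (c : LChain n m G) : pull f (mk c) = mk (LChain.pull f c) := rfl

end LClass

/-- The `Out^op`-diagram of simplicial sets `G ↦ L(G)_n / G`. -/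
def latticeQuot (n : ℕ∞) : OutCatᵒᵖ ⥤ SSet.{0} where
  obj G :=
    { obj := fun m => LClass n m.unop G.unop
      map := fun f => ↾(LClass.pull f.unop)
      map_id := fun m => by
        ext x
        obtain ⟨c, rfl⟩ := LClass.mk_surjective x
        rfl
      map_comp := fun f g => by
        ext x
        obtain ⟨c, rfl⟩ := LClass.mk_surjective x
        rfl }
  map f :=
    { app := fun m => ↾(LClass.comap f.unop)
      naturality := fun m m' g => by
        ext x
        obtain ⟨c, rfl⟩ := LClass.mk_surjective x
        obtain ⟨f', hf⟩ := OutCat.mkHom_surjective f.unop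
        rw [← hf]
        rfl }
  map_id G := by
    ext m x
    obtain ⟨c, rfl⟩ := LClass.mk_surjective x
    rfl
  map_comp f g := by
    ext m x
    obtain ⟨c, rfl⟩ := LClass.mk_surjective x
    obtain ⟨f', hf⟩ := OutCat.mkHom_surjective f.unop
    obtain ⟨g', hg⟩ := OutCat.mkHom_surjective g.unop
    simp only [unop_comp, ← hf, ← hg]
    rfl

/-! ### The complex -/

/-- The simplicial `ℚ[Out^op]`-module `ℚ[L(-)_n / -]`. -/
def latticeModule (n : ℕ∞) : SimplicialObject OutMod :=
  (latticeQuot n).flip ⋙ (Functor.whiskeringRight _ _ _).obj (ModuleCat.free ℚ)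

/-- The `k`-simplices of `L(G)_n / G` which are degenerate or lie in the subcomplex of chains not
ending in `G`. These vanish in the normalized chains on the pointed simplicial set obtained from
`L(G)_n / G` by collapsing this subcomplex to the base point. -/
def nullSimplices (n : ℕ∞) (k : ℕ) (G : OutCatᵒᵖ) : Set (((latticeQuot n).obj G) _⦋k⦌) :=
  ((latticeQuot n).obj G).degenerate k ∪
    {x | ∃ c : LChain n ⦋k⦌ G.unop, LClass.mk c = x ∧ c.1 (Fin.last _) ≠ ⊤}

/-- The submodule of null chains. -/
def nullSub (n : ℕ∞) (k : ℕ) : OutMod.Sub ((latticeModule n).obj (op ⦋k⦌)) where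
  carrier G := Submodule.span ℚ (ModuleCat.freeMk '' nullSimplices n k G)
  le_comap {G K} f := by
    rw [Submodule.span_le]
    rintro _ ⟨x, hx, rfl⟩
    refine Submodule.subset_span ⟨((latticeQuot n).map f).app _ x, ?_, ?_⟩
    · rcases hx with hx | ⟨c, rfl, hc⟩
      · exact Or.inl (SSet.degenerate_app_apply hx _)
      · obtain ⟨f', hf⟩ := OutCat.mkHom_surjective f.unop
        refine Or.inr ⟨LChain.comap f' c, ?_, ?_⟩
        · rw [← LClass.comap_mkHom_mk, hf]
          rfl
        · intro h
          apply hc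
          have h' : (c.1 (Fin.last _)).comap f'.1 = ⊤ := h
          rw [← Subgroup.map_comap_eq_self_of_surjective f'.2 (c.1 (Fin.last _)), h',
            Subgroup.map_top_of_surjective _ f'.2]
    · exact (ModuleCat.free_map_apply _ _).symm

lemma objD_freeMk (n : ℕ∞) (k : ℕ) (G : OutCatᵒᵖ) (x : ((latticeQuot n).obj G) _⦋k + 1⦌) :
    (AlgebraicTopology.AlternatingFaceMapComplex.objD (latticeModule n) k).app G
      (ModuleCat.freeMk x) =
    ∑ i : Fin (k + 2), (-1 : ℤ) ^ (i : ℕ) •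
      (ModuleCat.freeMk (((latticeQuot n).obj G).δ i x) :
        ((latticeModule n).obj (op ⦋k⦌)).obj G) := by
  rw [AlgebraicTopology.AlternatingFaceMapComplex.objD, NatTrans.app_sum]
  refine (LinearMap.congr_fun (ModuleCat.hom_sum _ _) _).trans ?_
  refine (LinearMap.sum_apply _ _ _).trans (Finset.sum_congr rfl fun i _ => ?_)
  rw [NatTrans.app_zsmul, ModuleCat.hom_zsmul]
  refine (LinearMap.smul_apply _ _ _).trans ?_
  congr 1
  exact ModuleCat.free_map_apply _ _

lemma null_face (n : ℕ∞) (k : ℕ) (G : OutCatᵒᵖ) :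
    (nullSub n (k + 1)).carrier G ≤ ((nullSub n k).carrier G).comap
      (((AlgebraicTopology.AlternatingFaceMapComplex.objD (latticeModule n) k).app G).hom) := by
  change Submodule.span ℚ _ ≤ _
  rw [Submodule.span_le]
  rintro _ ⟨x, hx, rfl⟩
  change (AlgebraicTopology.AlternatingFaceMapComplex.objD (latticeModule n) k).app G
    (ModuleCat.freeMk x) ∈ (nullSub n k).carrier G
  rw [objD_freeMk]
  rcases hx with hx | ⟨c, rfl, hc⟩
  · rw [SSet.degenerate_eq_iUnion_range_σ] at hx
    simp only [Set.mem_iUnion, Set.mem_range] at hx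
    obtain ⟨j, y, rfl⟩ := hx
    have hself : ((latticeQuot n).obj G).δ j.castSucc (((latticeQuot n).obj G).σ j y) = y :=
      ConcreteCategory.congr_hom (((latticeQuot n).obj G).δ_comp_σ_self (i := j)) y
    have hsucc : ((latticeQuot n).obj G).δ j.succ (((latticeQuot n).obj G).σ j y) = y :=
      ConcreteCategory.congr_hom (((latticeQuot n).obj G).δ_comp_σ_succ (i := j)) y
    have hne : j.succ ≠ j.castSucc := (Fin.castSucc_lt_succ).ne'
    rw [← Finset.add_sum_erase _ _ (Finset.mem_univ j.castSucc),
      ← Finset.add_sum_erase _ _ (Finset.mem_erase.2 ⟨hne, Finset.mem_univ j.succ⟩),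
      hself, hsucc, ← add_assoc, ← add_smul]
    have hs : ((-1 : ℤ) ^ (j.castSucc : ℕ) + (-1) ^ (j.succ : ℕ)) = 0 := by
      simp [pow_succ]
    rw [hs, zero_smul, zero_add]
    refine Submodule.sum_mem _ fun i hi => zsmul_mem ?_ _
    simp only [Finset.mem_erase, Finset.mem_univ, and_true] at hi
    refine Submodule.subset_span ⟨_, Or.inl ?_, rfl⟩
    obtain ⟨m, rfl⟩ : ∃ m, k = m + 1 := by
      cases k with
      | zero =>
        exfalso
        obtain ⟨h1, h2⟩ := hi
        fin_cases j
        fin_cases i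
        · exact h2 rfl
        · exact h1 rfl
      | succ m => exact ⟨m, rfl⟩
    rcases lt_or_gt_of_ne hi.2 with h | h
    · have hj : j ≠ 0 := by
        rintro rfl
        simp at h
      obtain ⟨j', rfl⟩ := Fin.exists_succ_eq.2 hj
      obtain ⟨i', rfl⟩ := Fin.exists_castSucc_eq.2 (h.trans_le (Fin.le_last _)).ne
      have hle : i' ≤ j'.castSucc := by
        simp only [Fin.lt_def, Fin.le_def, Fin.val_castSucc, Fin.val_succ] at h ⊢
        lia
      have := ConcreteCategory.congr_hom (((latticeQuot n).obj G).δ_comp_σ_of_le hle) y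
      simp only [CategoryTheory.comp_apply] at this
      rw [this]
      exact SSet.σ_mem_degenerate _ _ _
    · have hlt : j.succ < i := by
        have h1 := hi.1
        simp only [Fin.lt_def, Fin.val_castSucc, Fin.val_succ, ne_eq, Fin.ext_iff] at h h1 ⊢
        lia
      have := ConcreteCategory.congr_hom (((latticeQuot n).obj G).δ_comp_σ_of_gt' hlt) y
      simp only [CategoryTheory.comp_apply] at this
      rw [this]
      exact SSet.σ_mem_degenerate _ _ _
  · refine Submodule.sum_mem _ fun i _ => zsmul_mem ?_ _
    refine Submodule.subset_span ⟨_, Or.inr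
      ⟨LChain.pull (SimplexCategory.δ i) c, rfl, fun h => hc (top_le_iff.1 ?_)⟩, rfl⟩
    rw [← h]
    exact c.1.monotone (Fin.le_last _)

/-- The complex `𝒞L̃_n` of `ℚ[Out^op]`-modules: the normalized rational chains on the `Out^op`-diagram
of pointed simplicial sets `G ↦ L̃(G)_n / G`. -/
def CL (n : ℕ∞) : ChainComplex OutMod ℕ :=
  ChainComplex.of (fun k => (nullSub n k).quotient)
    (fun k => (nullSub n (k + 1)).map (nullSub n k)
      (AlgebraicTopology.AlternatingFaceMapComplex.objD (latticeModule n) k) (null_face n k))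
    (fun k => by
      apply OutMod.Sub.hom_ext
      rw [← Category.assoc, OutMod.Sub.proj_map, Category.assoc, OutMod.Sub.proj_map,
        ← Category.assoc, AlgebraicTopology.AlternatingFaceMapComplex.d_squared]
      simp)

/-! ### Simple chains -/

/-- Simple chains `H₀ < ⋯ < H_k` of finite groups with `[H_k : H₀] ≤ n`, where `H_k` is regarded as
the ambient group: `H₀` contains no nontrivial normal subgroup of `H_k`. -/
structure SimpleChain (n : ℕ∞) (k : ℕ) where
  top : OutCat
  chain : Fin (k + 1) → Subgroup top
  strictMono : StrictMono chain
  last_eq : chain (Fin.last k) = ⊤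
  simple : ∀ N : Subgroup top, N.Normal → N ≤ chain 0 → N = ⊥
  index_le : ((chain 0).index : ℕ∞) ≤ n

namespace SimpleChain

variable {n : ℕ∞} {k : ℕ}

/-- Isomorphism of chains. -/
def isoSetoid (n : ℕ∞) (k : ℕ) : Setoid (SimpleChain n k) where
  r c d := ∃ e : c.top ≃* d.top, ∀ i, (c.chain i).map e.toMonoidHom = d.chain i
  iseqv :=
    { refl := fun c => ⟨MulEquiv.refl _, fun i => Subgroup.map_id _⟩
      symm := by
        rintro c d ⟨e, h⟩
        refine ⟨e.symm, fun i => ?_⟩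
        rw [← h, Subgroup.map_map]
        ext x
        simp
      trans := by
        rintro c d b ⟨e, h⟩ ⟨e', h'⟩
        refine ⟨e.trans e', fun i => ?_⟩
        rw [← h', ← h, Subgroup.map_map]
        rfl }

/-- A simple chain as a simplex of `L(H_k)_n`. -/
def toLChain (c : SimpleChain n k) : LChain n ⦋k⦌ c.top :=
  ⟨⟨c.chain, c.strictMono.monotone⟩, by
    change ((c.chain 0).relIndex (c.chain (Fin.last k)) : ℕ∞) ≤ n
    rw [c.last_eq, Subgroup.relIndex_top_right]
    exact c.index_le⟩

/-- An isomorphism of finite groups as a surjection. -/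
def _root_.OutCat.ofEquiv {G K : OutCat} (e : G ≃* K) : OutCat.Epim G K :=
  ⟨e.toMonoidHom, e.surjective⟩

/-- The group `Out(H₀ < ⋯ < H_k)` of conjugacy classes of automorphisms of `H_k` which map the chain
to a conjugate of itself. -/
def outGroup (c : SimpleChain n k) : Subgroup (Aut c.top) where
  carrier := {α | ∃ e : c.top ≃* c.top, OutCat.mkHom (OutCat.ofEquiv e) = α.hom ∧
    ∃ g : c.top, ∀ i,
      (c.chain i).map e.toMonoidHom = (c.chain i).map (MulAut.conj g).toMonoidHom}
  one_mem' := ⟨MulEquiv.refl _, rfl, 1, fun i => by ext x; simp⟩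
  mul_mem' := by
    rintro α β ⟨e, he, g, hg⟩ ⟨e', he', g', hg'⟩
    refine ⟨e'.trans e, ?_, e g' * g, fun i => ?_⟩
    · change _ = β.hom ≫ α.hom
      rw [← he, ← he']
      rfl
    · have h1 : (c.chain i).map (e'.trans e).toMonoidHom =
          ((c.chain i).map e'.toMonoidHom).map e.toMonoidHom := by
        rw [Subgroup.map_map]; rfl
      have h2 : ((c.chain i).map (MulAut.conj g').toMonoidHom).map e.toMonoidHom =
          ((c.chain i).map e.toMonoidHom).map (MulAut.conj (e g')).toMonoidHom := by
        rw [Subgroup.map_map, Subgroup.map_map]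
        congr 1
        ext x
        simp
      rw [h1, hg', h2, hg, Subgroup.map_map]
      congr 1
      ext x
      simp [mul_assoc]
  inv_mem' := by
    rintro α ⟨e, he, g, hg⟩
    refine ⟨e.symm, ?_, e.symm g⁻¹, fun i => ?_⟩
    · let a : c.top ≅ c.top := α
      change _ = a.inv
      change _ = a.hom at he
      rw [← cancel_epi a.hom, a.hom_inv_id, ← he, OutCat.mkHom_comp, ← OutCat.mkHom_id]
      congr 1
      ext x
      simp [OutCat.ofEquiv]
    · apply Subgroup.map_injective (f := e.toMonoidHom) e.injective
      have h2 : ((c.chain i).map (MulAut.conj (e.symm g⁻¹)).toMonoidHom).map e.toMonoidHom =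
          ((c.chain i).map e.toMonoidHom).map (MulAut.conj g⁻¹).toMonoidHom := by
        rw [Subgroup.map_map, Subgroup.map_map]
        congr 1
        ext x
        simp
      rw [h2, hg, Subgroup.map_map, Subgroup.map_map]
      congr 1
      ext x
      simp [mul_assoc]

/-- The relations `α ∘ ψ ~ ψ` for `α` in `Out(H₀ < ⋯ < H_k)` in the representable module
`ℚ[Out(-, H_k)]`. -/
def orbitSub (c : SimpleChain n k) :
    OutMod.Sub (yoneda.obj c.top ⋙ ModuleCat.free ℚ) where
  carrier G := Submodule.span ℚ {v | ∃ α ∈ c.outGroup, ∃ ψ : G.unop ⟶ c.top,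
    v = ModuleCat.freeMk (ψ ≫ α.hom) - ModuleCat.freeMk ψ}
  le_comap {G K} f := by
    rw [Submodule.span_le]
    rintro _ ⟨α, hα, ψ, rfl⟩
    refine Submodule.subset_span ⟨α, hα, f.unop ≫ ψ, ?_⟩
    simp only [Functor.comp_map, map_sub]
    erw [ModuleCat.free_map_apply, ModuleCat.free_map_apply]
    simp

/-- The orbit module `ℚ[Out(-, H_k)] / Out(H₀ < ⋯ < H_k)`. -/
def orbitModule (c : SimpleChain n k) : OutMod := c.orbitSub.quotient

/-- The map `ℚ[Out(-, H_k)] ⟶ ℚ[(L(-)_n / -)_k]` sending `ψ : G ↠ H_k` to the chain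
`ψ⁻¹(H₀) < ⋯ < ψ⁻¹(H_k) = G`. -/
def preimageMap (c : SimpleChain n k) :
    yoneda.obj c.top ⋙ ModuleCat.free ℚ ⟶ (latticeModule n).obj (op ⦋k⦌) :=
  Functor.whiskerRight
    (yonedaEquiv.symm (LClass.mk c.toLChain) :
      yoneda.obj c.top ⟶ (latticeQuot n).flip.obj (op ⦋k⦌)) (ModuleCat.free ℚ)

lemma preimageMap_freeMk (c : SimpleChain n k) (G : OutCatᵒᵖ) (ψ : G.unop ⟶ c.top) :
    c.preimageMap.app G (ModuleCat.freeMk ψ) =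
      ModuleCat.freeMk (LClass.comap ψ (LClass.mk c.toLChain)) :=
  ModuleCat.free_map_apply _ _

lemma comap_outGroup (c : SimpleChain n k) {α : Aut c.top} (hα : α ∈ c.outGroup) :
    LClass.comap α.hom (LClass.mk c.toLChain) = LClass.mk c.toLChain := by
  obtain ⟨e, he, g, hg⟩ := hα
  rw [← he, LClass.comap_mkHom_mk, LClass.mk_eq_iff]
  refine ⟨e.symm g, fun i => ?_⟩
  change c.chain i = ((c.chain i).comap e.toMonoidHom).map (MulAut.conj (e.symm g)).toMonoidHom
  ext x
  have hx : e x ∈ (c.chain i).map e.toMonoidHom ↔ x ∈ c.chain i :=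
    Subgroup.mem_map_equiv.trans (by simp)
  rw [mem_map_conj_iff, Subgroup.mem_comap, ← hx, hg, mem_map_conj_iff]
  simp

/-- The map `ℚ[Out(-, H_k)] / Out(H₀ < ⋯ < H_k) ⟶ (𝒞L̃_n)_k` sending the class of
`ψ : G ↠ H_k` to the class of the chain `ψ⁻¹(H₀) < ⋯ < ψ⁻¹(H_k) = G`. -/
def orbitMap (c : SimpleChain n k) : c.orbitModule ⟶ (CL n).X k :=
  c.orbitSub.map (nullSub n k) c.preimageMap (fun G => by
    change Submodule.span ℚ _ ≤ _
    rw [Submodule.span_le]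
    rintro _ ⟨α, hα, ψ, rfl⟩
    have h : LClass.comap (ψ ≫ α.hom) (LClass.mk c.toLChain) =
        LClass.comap ψ (LClass.mk c.toLChain) := by
      conv_rhs => rw [← c.comap_outGroup hα]
      exact ConcreteCategory.congr_hom
        (congrArg (fun t => t.app (op ⦋k⦌)) ((latticeQuot n).map_comp α.hom.op ψ.op)) _
    change c.preimageMap.app G _ ∈ (nullSub n k).carrier G
    rw [map_sub]
    refine (congrArg (fun t => t ∈ (nullSub n k).carrier G) (sub_eq_zero.2 ?_)).mpr
      (Submodule.zero_mem _)
    exact (c.preimageMap_freeMk G _).trans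
      ((congrArg ModuleCat.freeMk h).trans (c.preimageMap_freeMk G ψ).symm))

end SimpleChain

/-- Isomorphism classes of simple chains of length `k` and total index at most `n`. -/
def SimpleChainClass (n : ℕ∞) (k : ℕ) : Type 1 := Quotient (SimpleChain.isoSetoid n k)

/-- A chosen representative of an isomorphism class. -/
def SimpleChainClass.rep {n : ℕ∞} {k : ℕ} (x : SimpleChainClass n k) : SimpleChain n k :=
  Quotient.out x

/-- The modules `ℚ[Out(-, H_k)] / Out(H₀ < ⋯ < H_k)`, one for each isomorphism class of simple chains
of total index at most `n`, with their maps to `(𝒞L̃_n)_k`. That this cofan is a colimit means that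
`(𝒞L̃_n)_k` is the direct sum of these modules along these maps. -/
def orbitCofan (n : ℕ∞) (k : ℕ) :
    Cofan (fun x : SimpleChainClass n k => x.rep.orbitModule) :=
  Cofan.mk ((CL n).X k) (fun x => x.rep.orbitMap)

end

/-!
A `k`-simplex of `L(G)_n / G` survives in `𝒞L̃_n` exactly if it is the class of a strict chain
`H₀ < ⋯ < H_k = G`. Dividing by the normal core of `H₀` writes it as the preimage of a simple chain
under the projection, and conversely a surjection onto a simple chain recovers this normal core as
its kernel, so that the simple chain is unique up to isomorphism and the surjection up to `Out` of
the chain. Hence `(𝒞L̃_n)_k` is the direct sum of the orbit modules. Each orbit module is a quotient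
of a representable by a finite group; over `ℚ` averaging splits the projection, so it is projective.
Finally, putting the trivial subgroup at the bottom of a chain contracts the nerve of the subgroup
lattice of `G`; the cone point `[1]` vanishes in `𝒞L̃` unless `G` is trivial. This contraction is
not natural in `G`, but exactness is checked one group at a time.
-/

noncomputable section

lemma projective_of_isColimit_cofan {C : Type*} [Category C] {ι : Type*} {f : ι → C}
    (c : Cofan f) (hc : IsColimit c) (h : ∀ i, Projective (f i)) : Projective c.pt where
  factors g e he := by
    refine ⟨Cofan.IsColimit.desc hc fun i => Projective.factorThru (c.inj i ≫ g) e,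
      Cofan.IsColimit.hom_ext hc _ _ fun i => ?_⟩
    rw [Cofan.IsColimit.fac_assoc, Projective.factorThru_comp]

section Average

variable {C : Type*} [Category C] [Preadditive C] (K : Type*) [Field K] [Linear K C]
  {A : Type*} [Group A] [Fintype A] {P Q : C}

/-- The average of a finite group acting on an object of a linear category. -/
def actionAverage (ρ : A →* End P) : P ⟶ P :=
  (Fintype.card A : K)⁻¹ • ∑ a, ρ a

lemma comp_actionAverage (ρ : A →* End P) (a : A) :
    (ρ a).asHom ≫ actionAverage K ρ = actionAverage K ρ := by
  rw [actionAverage, Linear.comp_smul, Preadditive.comp_sum]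
  congr 1
  exact Fintype.sum_equiv (Equiv.mulRight a) _ _ fun b => (map_mul ρ b a).symm

lemma actionAverage_comp [CharZero K] (ρ : A →* End P) {π : P ⟶ Q}
    (h : ∀ a, (ρ a).asHom ≫ π = π) : actionAverage K ρ ≫ π = π := by
  rw [actionAverage, Linear.smul_comp, Preadditive.sum_comp, Finset.sum_congr rfl fun a _ => h a,
    Finset.sum_const, Finset.card_univ, ← Nat.cast_smul_eq_nsmul K, smul_smul,
    inv_mul_cancel₀ (Nat.cast_ne_zero.2 Fintype.card_ne_zero), one_smul]

end Average

section FunctorCategory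

universe v

variable {C : Type*} [Category C]

instance projective_yoneda (X : C) : Projective (yoneda.obj X) where
  factors {E B} f e _ := by
    obtain ⟨y, hy⟩ := (epi_iff_surjective (e.app (op X))).1 inferInstance (yonedaEquiv f)
    refine ⟨yonedaEquiv.symm y, yonedaEquiv.injective ?_⟩
    rw [yonedaEquiv_comp, Equiv.apply_symm_apply, hy]

lemma preservesEpimorphisms_whiskeringRight_forget (R : Type v) [Ring R] :
    ((Functor.whiskeringRight C _ _).obj (forget (ModuleCat.{v} R))).PreservesEpimorphisms where
  preserves f _ :=
    have (X : C) : Epi ((Functor.whiskerRight f (forget (ModuleCat.{v} R))).app X) :=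
      (forget (ModuleCat.{v} R)).map_epi (f.app X)
    NatTrans.epi_of_epi_app (Functor.whiskerRight f (forget (ModuleCat.{v} R)))

lemma projective_comp_free (R : Type v) [Ring R] (F : C ⥤ Type v) [Projective F] :
    Projective (F ⋙ ModuleCat.free R) :=
  have := preservesEpimorphisms_whiskeringRight_forget (C := C) R
  ((ModuleCat.adj R).whiskerRight C).map_projective F inferInstance

lemma free_functor_hom_ext {R : Type v} [Ring R] {F : C ⥤ Type v} {E : C ⥤ ModuleCat.{v} R}
    {f g : F ⋙ ModuleCat.free R ⟶ E}
    (h : ∀ X (x : F.obj X), f.app X (ModuleCat.freeMk x) = g.app X (ModuleCat.freeMk x)) :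
    f = g := by
  ext X : 2
  exact ModuleCat.free_hom_ext (h X)

lemma exact_of_forall_exact_app {V : Type*} [Category V] [Abelian V] (S : ShortComplex (C ⥤ V))
    (h : ∀ X, (S.map ((evaluation C V).obj X)).Exact) : S.Exact := by
  rw [ShortComplex.exact_iff_isZero_homology, Functor.isZero_iff]
  intro X
  exact ((ShortComplex.exact_iff_isZero_homology _).1 (h X)).of_iso
    (S.mapHomologyIso ((evaluation C V).obj X)).symm

end FunctorCategory

lemma exact_of_comp_add_comp_eq_id {R : Type*} [Ring R] (S : ShortComplex (ModuleCat R))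
    (s : S.X₂ →ₗ[R] S.X₁) (r : S.X₃ →ₗ[R] S.X₂)
    (h : S.f.hom ∘ₗ s + r ∘ₗ S.g.hom = LinearMap.id) : S.Exact := by
  refine (ShortComplex.moduleCat_exact_iff S).2 fun x hx => ⟨s x, ?_⟩
  have hsx : S.f.hom (s x) + r (S.g.hom x) = x := LinearMap.congr_fun h x
  rwa [hx, map_zero, add_zero] at hsx

lemma quasiIso_toSingle₀Equiv_symm {V : Type*} [Category V] [Abelian V] (K : ChainComplex V ℕ)
    {X : V} (ε : K.X 0 ⟶ X) [Epi ε] (w : K.d 1 0 ≫ ε = 0) (h₀ : (ShortComplex.mk _ _ w).Exact)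
    (h : ∀ i, K.ExactAt (i + 1)) : QuasiIso ((K.toSingle₀Equiv X).symm ⟨ε, w⟩) where
  quasiIsoAt
    | 0 => by
      rw [ChainComplex.quasiIsoAt₀_iff, ShortComplex.quasiIso_iff_of_zeros' _
        (K.shape _ _ (by simp)) rfl rfl]
      refine (ShortComplex.exact_and_epi_g_iff_of_iso
        (S₂ := ShortComplex.mk _ _ w) ?_).2 ⟨h₀, ‹Epi ε›⟩
      exact ShortComplex.isoMk (Iso.refl _) (Iso.refl _) (Iso.refl _)
        ((Category.id_comp _).trans (Category.comp_id _).symm)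
        ((Category.id_comp _).trans ((Category.comp_id _).trans
          (ChainComplex.toSingle₀Equiv_symm_apply_f_zero ε w)).symm)
    | i + 1 => by
      rw [quasiIsoAt_iff_exactAt' _ _ (ChainComplex.exactAt_succ_single_obj X i)]
      exact h i

namespace OutCat

instance (G K : OutCat) : Finite (G ⟶ K) :=
  have : Finite (G →* K) := .of_injective _ DFunLike.coe_injective
  .of_surjective _ mkHom_surjective

instance (G : OutCat) : Finite (Aut G) :=
  .of_injective (fun α : Aut G => α.hom) fun _ _ h => Iso.ext h

/-- An isomorphism of finite groups as an isomorphism in `Out`. -/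
def isoOfEquiv {G K : OutCat} (e : G ≃* K) : G ≅ K where
  hom := mkHom (ofEquiv e)
  inv := mkHom (ofEquiv e.symm)
  hom_inv_id := congrArg mkHom (Subtype.ext (MonoidHom.ext e.symm_apply_apply))
  inv_hom_id := congrArg mkHom (Subtype.ext (MonoidHom.ext e.apply_symm_apply))

end OutCat

namespace OutMod.Sub

variable {P Q : OutMod} (N : Sub P)

/-- The map induced on a quotient by a map vanishing on the submodule. -/
def desc (f : P ⟶ Q) (h : ∀ G, N.carrier G ≤ LinearMap.ker (f.app G).hom) : N.quotient ⟶ Q where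
  app G := ModuleCat.ofHom (Submodule.liftQ _ (f.app G).hom (h G))
  naturality G K g := by
    ext : 1
    exact Submodule.linearMap_qext _
      (LinearMap.ext fun x => ConcreteCategory.congr_hom (f.naturality g) x)

lemma proj_desc (f : P ⟶ Q) (h : ∀ G, N.carrier G ≤ LinearMap.ker (f.app G).hom) :
    N.proj ≫ N.desc f h = f := rfl

end OutMod.Sub

namespace SimpleChain

variable {n : ℕ∞} {k : ℕ}

/-- The action of `Out(H₀ < ⋯ < H_k)` on `ℚ[Out(-, H_k)]` by postcomposition. -/
def outAction (c : SimpleChain n k) : c.outGroup →* End (yoneda.obj c.top ⋙ ModuleCat.free ℚ) :=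
  ((yoneda ⋙ (Functor.whiskeringRight _ _ _).obj (ModuleCat.free ℚ)).mapEnd c.top).comp
    ((Aut.toEnd c.top).comp c.outGroup.subtype)

lemma outAction_app_freeMk (c : SimpleChain n k) (α : c.outGroup) (G : OutCatᵒᵖ)
    (ψ : G.unop ⟶ c.top) :
    NatTrans.app (c.outAction α) G (ModuleCat.freeMk ψ) = ModuleCat.freeMk (ψ ≫ α.1.hom) :=
  ModuleCat.free_map_apply _ _

lemma outAction_comp_proj (c : SimpleChain n k) (α : c.outGroup) :
    (c.outAction α).asHom ≫ c.orbitSub.proj = c.orbitSub.proj := by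
  refine free_functor_hom_ext fun G (ψ : G.unop ⟶ c.top) => ?_
  refine (congrArg (c.orbitSub.proj.app G) (c.outAction_app_freeMk α G ψ)).trans ?_
  exact (Submodule.Quotient.eq _).2 (Submodule.subset_span ⟨α.1, α.2, ψ, rfl⟩)

lemma orbitSub_le_ker (c : SimpleChain n k) {Q : OutMod}
    (f : yoneda.obj c.top ⋙ ModuleCat.free ℚ ⟶ Q)
    (h : ∀ α, (c.outAction α).asHom ≫ f = f) (G : OutCatᵒᵖ) :
    c.orbitSub.carrier G ≤ LinearMap.ker (f.app G).hom := by
  refine Submodule.span_le.2 ?_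
  rintro _ ⟨α, hα, ψ, rfl⟩
  have hψ := ConcreteCategory.congr_hom (NatTrans.congr_app (h ⟨α, hα⟩) G) (ModuleCat.freeMk ψ)
  refine (map_sub (f.app G).hom _ _).trans (sub_eq_zero.2 (Eq.trans ?_ hψ))
  exact congrArg (f.app G) (c.outAction_app_freeMk ⟨α, hα⟩ G ψ).symm

instance (c : SimpleChain n k) : Fintype c.outGroup := Fintype.ofFinite _

lemma projective_orbitModule (c : SimpleChain n k) : Projective c.orbitModule := by
  have : Projective (yoneda.obj c.top ⋙ ModuleCat.free ℚ) := projective_comp_free ℚ _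
  let s := c.orbitSub.desc (actionAverage ℚ c.outAction)
    (c.orbitSub_le_ker _ (comp_actionAverage ℚ c.outAction))
  have hs : c.orbitSub.proj ≫ s = actionAverage ℚ c.outAction := OutMod.Sub.proj_desc _ _ _
  refine Retract.projective ⟨s, c.orbitSub.proj, OutMod.Sub.hom_ext _ ?_⟩
  exact (congrArg (· ≫ c.orbitSub.proj) hs).trans
    ((actionAverage_comp ℚ c.outAction c.outAction_comp_proj).trans (Category.comp_id _).symm)

end SimpleChain

/-! ### Preimages of simple chains -/

section Group

variable {G K M : Type*} [Group G] [Group K] [Group M]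

lemma normalCore_comap_of_surjective (H : Subgroup K) {f : G →* K} (hf : Function.Surjective f) :
    (H.comap f).normalCore = H.normalCore.comap f := by
  refine le_antisymm (Subgroup.map_le_iff_le_comap.1 ?_)
    (Subgroup.normal_le_normalCore.2 (Subgroup.comap_mono H.normalCore_le))
  have := (H.comap f).normalCore_normal.map f hf
  exact Subgroup.normal_le_normalCore.2 (Subgroup.map_le_iff_le_comap.2 (Subgroup.normalCore_le _))

lemma comap_mk'_map_mk'_eq_self (N H : Subgroup G) [N.Normal] (h : N ≤ H) :
    (H.map (QuotientGroup.mk' N)).comap (QuotientGroup.mk' N) = H := by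
  rw [QuotientGroup.comap_map_mk', sup_of_le_right h]

lemma normalCore_map_mk'_normalCore (H : Subgroup G) :
    (H.map (QuotientGroup.mk' H.normalCore)).normalCore = ⊥ := by
  have hsurj := QuotientGroup.mk'_surjective H.normalCore
  refine Subgroup.comap_injective hsurj ?_
  rw [← normalCore_comap_of_surjective _ hsurj, comap_mk'_map_mk'_eq_self _ _ H.normalCore_le,
    MonoidHom.comap_bot, QuotientGroup.ker_mk']

lemma exists_mulEquiv_comp_eq_of_ker_eq {f : G →* K} {g : G →* M} (hf : Function.Surjective f)
    (hg : Function.Surjective g) (h : f.ker = g.ker) :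
    ∃ e : K ≃* M, e.toMonoidHom.comp f = g := by
  refine ⟨(QuotientGroup.quotientKerEquivOfSurjective f hf).symm.trans
    ((QuotientGroup.quotientMulEquivOfEq h).trans
      (QuotientGroup.quotientKerEquivOfSurjective g hg)), MonoidHom.ext fun x => ?_⟩
  have hx : (QuotientGroup.quotientKerEquivOfSurjective f hf).symm (f x) = QuotientGroup.mk x :=
    (MulEquiv.symm_apply_eq _).2 rfl
  exact congrArg ((QuotientGroup.quotientMulEquivOfEq h).trans
    (QuotientGroup.quotientKerEquivOfSurjective g hg)) hx

end Group

namespace LChain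

lemma comap_map_mk'_normalCore {n : ℕ∞} {k : ℕ} {G : OutCat} (c : LChain n ⦋k⦌ G)
    (i : Fin (k + 1)) :
    ((c.1 i).map (QuotientGroup.mk' (c.1 0).normalCore)).comap
      (QuotientGroup.mk' (c.1 0).normalCore) = c.1 i :=
  comap_mk'_map_mk'_eq_self _ _ ((c.1 0).normalCore_le.trans (c.1.monotone (Fin.zero_le i)))

end LChain

namespace LClass

variable {n : ℕ∞} {k : ℕ} {G K M : OutCat}

lemma mk_mem_range_σ_iff (c : LChain n ⦋k + 1⦌ G) (j : Fin (k + 1)) :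
    mk c ∈ Set.range (((latticeQuot n).obj (op G)).σ j) ↔ c.1 j.castSucc = c.1 j.succ := by
  constructor
  · rintro ⟨y, hy⟩
    obtain ⟨d, rfl⟩ := mk_surjective y
    obtain ⟨g, hg⟩ := (mk_eq_iff (LChain.pull (SimplexCategory.σ j) d) c).1 hy
    have hd : d.1 (j.predAbove j.castSucc) = d.1 (j.predAbove j.succ) := by
      simp only [Fin.predAbove_castSucc_self, Fin.predAbove_succ_self]
    exact (hg _).trans ((congrArg _ hd).trans (hg _).symm)
  · intro h
    refine ⟨pull (SimplexCategory.δ j.succ) (mk c),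
      congrArg mk (Subtype.ext (OrderHom.ext _ _ (funext fun i => ?_)))⟩
    change c.1 (j.succ.succAbove (j.predAbove i)) = c.1 i
    by_cases hi : i = j.succ
    · rw [hi, ← h, Fin.predAbove_succ_self, Fin.succAbove_succ_self]
    · rw [Fin.succ_succAbove_predAbove hi]

lemma mk_mem_degenerate_iff (c : LChain n ⦋k⦌ G) :
    mk c ∈ ((latticeQuot n).obj (op G)).degenerate k ↔ ¬ StrictMono c.1 := by
  cases k with
  | zero =>
    rw [SSet.degenerate_zero]
    exact iff_of_false id (not_not.2 (Subsingleton.strictMono (α := Fin 1) _))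
  | succ k =>
    rw [SSet.degenerate_eq_iUnion_range_σ, Fin.strictMono_iff_lt_succ, not_forall]
    refine Set.mem_iUnion.trans (exists_congr fun i => (mk_mem_range_σ_iff c i).trans ?_)
    exact (c.1.monotone (Fin.castSucc_le_succ i)).not_lt_iff_eq.symm

lemma eq_top_iff_of_mk_eq {c d : LChain n ⦋k⦌ G} (h : mk c = mk d) (i : Fin (k + 1)) :
    c.1 i = ⊤ ↔ d.1 i = ⊤ := by
  obtain ⟨g, hg⟩ := (mk_eq_iff c d).1 h
  have hsurj : Function.Surjective (MulAut.conj g).toMonoidHom := (MulAut.conj g).surjective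
  rw [hg, ← (Subgroup.map_injective (f := (MulAut.conj g).toMonoidHom)
    (MulAut.conj g).injective).eq_iff, Subgroup.map_top_of_surjective _ hsurj]

lemma mk_mem_nullSimplices_iff (c : LChain n ⦋k⦌ G) :
    mk c ∈ nullSimplices n k (op G) ↔ ¬ (StrictMono c.1 ∧ c.1 (Fin.last k) = ⊤) := by
  rw [not_and_or, ← mk_mem_degenerate_iff]
  refine or_congr_right ⟨?_, fun h => ⟨c, rfl, h⟩⟩
  rintro ⟨d, hd, h⟩
  exact mt (eq_top_iff_of_mk_eq hd _).2 h

lemma comap_mem_nullSimplices_iff (f : G ⟶ K) (y : LClass n ⦋k⦌ K) :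
    comap f y ∈ nullSimplices n k (op G) ↔ y ∈ nullSimplices n k (op K) := by
  obtain ⟨c, rfl⟩ := mk_surjective y
  obtain ⟨f, rfl⟩ := OutCat.mkHom_surjective f
  rw [comap_mkHom_mk, mk_mem_nullSimplices_iff, mk_mem_nullSimplices_iff, not_iff_not]
  refine and_congr (forall₂_congr fun i j => imp_congr_right fun _ => ?_) ?_
  · exact Subgroup.comap_lt_comap_of_surjective f.2
  · rw [← (Subgroup.comap_injective f.2).eq_iff, Subgroup.comap_top]
    rfl

lemma comap_comp {m : SimplexCategory} (f : G ⟶ K) (g : K ⟶ M) (y : LClass n m M) :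
    comap (f ≫ g) y = comap f (comap g y) :=
  ConcreteCategory.congr_hom (NatTrans.congr_app ((latticeQuot n).map_comp g.op f.op) (op m)) y

lemma exists_comap_eq_of_comap_mk_eq_mk {m : SimplexCategory} {φ : G ⟶ K} {d : LChain n m K}
    {c : LChain n m G} (h : comap φ (mk d) = mk c) :
    ∃ f : OutCat.Epim G K, OutCat.mkHom f = φ ∧ LChain.comap f d = c := by
  obtain ⟨f, rfl⟩ := OutCat.mkHom_surjective φ
  obtain ⟨a, ha⟩ := (mk_eq_iff (LChain.comap f d) c).1 h
  refine ⟨⟨(MulAut.conj (f.1 a)⁻¹).toMonoidHom.comp f.1,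
    (MulAut.conj (f.1 a)⁻¹).surjective.comp f.2⟩, ?_, ?_⟩
  · refine (OutCat.mkHom_eq_iff _ _).2 ⟨f.1 a, fun x => ?_⟩
    simp [mul_assoc]
  · refine Subtype.ext (OrderHom.ext _ _ (funext fun i => SetLike.ext fun x => ?_))
    rw [ha i, mem_map_conj_iff]
    change MulAut.conj (f.1 a)⁻¹ (f.1 x) ∈ d.1 i ↔ f.1 (a⁻¹ * x * a) ∈ d.1 i
    simp

end LClass

namespace SimpleChain

variable {n : ℕ∞} {k : ℕ} {G : OutCat}

lemma normalCore_chain_zero (c : SimpleChain n k) : (c.chain 0).normalCore = ⊥ :=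
  c.simple _ inferInstance (Subgroup.normalCore_le _)

lemma ker_eq_normalCore_comap (c : SimpleChain n k) (f : OutCat.Epim G c.top) :
    f.1.ker = ((c.chain 0).comap f.1).normalCore := by
  rw [normalCore_comap_of_surjective _ f.2, c.normalCore_chain_zero, MonoidHom.comap_bot]

/-- The class `[ψ⁻¹(H₀) < ⋯ < ψ⁻¹(H_k)]` of simplices of `L(G)_n / G`. -/
def preimage (c : SimpleChain n k) (ψ : G ⟶ c.top) : LClass n ⦋k⦌ G :=
  LClass.comap ψ (LClass.mk c.toLChain)

lemma preimage_notMem_nullSimplices (c : SimpleChain n k) (ψ : G ⟶ c.top) :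
    c.preimage ψ ∉ nullSimplices n k (op G) := by
  rw [preimage, LClass.comap_mem_nullSimplices_iff, LClass.mk_mem_nullSimplices_iff, not_not]
  exact ⟨c.strictMono, c.last_eq⟩

lemma comap_preimage {K : OutCat} (c : SimpleChain n k) (f : K ⟶ G) (ψ : G ⟶ c.top) :
    LClass.comap f (c.preimage ψ) = c.preimage (f ≫ ψ) :=
  (LClass.comap_comp _ _ _).symm

lemma exists_equiv_of_comap_eq {c d : SimpleChain n k} (f : OutCat.Epim G c.top)
    (g : OutCat.Epim G d.top) (h : LChain.comap f c.toLChain = LChain.comap g d.toLChain) :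
    ∃ e : c.top ≃* d.top, (∀ i, (c.chain i).map e.toMonoidHom = d.chain i) ∧
      OutCat.mkHom f ≫ OutCat.mkHom (OutCat.ofEquiv e) = OutCat.mkHom g := by
  have hcomap (i : Fin (k + 1)) : (c.chain i).comap f.1 = (d.chain i).comap g.1 :=
    DFunLike.congr_fun (congrArg Subtype.val h) i
  have hker : f.1.ker = g.1.ker := by
    rw [c.ker_eq_normalCore_comap f, d.ker_eq_normalCore_comap g, hcomap]
  obtain ⟨e, he⟩ := exists_mulEquiv_comp_eq_of_ker_eq f.2 g.2 hker
  refine ⟨e, fun i => Subgroup.comap_injective g.2 ?_, congrArg OutCat.mkHom (Subtype.ext he)⟩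
  rw [← hcomap, ← he, ← Subgroup.comap_comap,
    Subgroup.comap_map_eq_self_of_injective e.injective]

lemma exists_equiv_of_preimage_eq {c d : SimpleChain n k} {ψ : G ⟶ c.top} {φ : G ⟶ d.top}
    (h : c.preimage ψ = d.preimage φ) :
    ∃ e : c.top ≃* d.top, (∀ i, (c.chain i).map e.toMonoidHom = d.chain i) ∧
      ψ ≫ OutCat.mkHom (OutCat.ofEquiv e) = φ := by
  obtain ⟨g, rfl⟩ := OutCat.mkHom_surjective φ
  obtain ⟨f, rfl, hf⟩ := LClass.exists_comap_eq_of_comap_mk_eq_mk h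
  exact exists_equiv_of_comap_eq f g hf

/-- The simple chain obtained from a strict chain ending in the whole group by dividing out the
normal core of its smallest member. -/
def ofLChain (c : LChain n ⦋k⦌ G) (hc : StrictMono c.1) (hl : c.1 (Fin.last k) = ⊤) :
    SimpleChain n k where
  top := OutCat.of (G ⧸ (c.1 0).normalCore)
  chain i := (c.1 i).map (QuotientGroup.mk' (c.1 0).normalCore)
  strictMono i j h := by
    rw [← Subgroup.comap_lt_comap_of_surjective (QuotientGroup.mk'_surjective (c.1 0).normalCore)]
    exact (c.comap_map_mk'_normalCore i).trans_lt
      ((hc h).trans_eq (c.comap_map_mk'_normalCore j).symm)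
  last_eq := (congrArg (Subgroup.map _) hl).trans
    (Subgroup.map_top_of_surjective _ (QuotientGroup.mk'_surjective _))
  simple _ _ h := le_bot_iff.1 <|
    (Subgroup.normal_le_normalCore.2 h).trans_eq (normalCore_map_mk'_normalCore (c.1 0))
  index_le := by
    have hindex : (c.1 0).relIndex (c.1 (Fin.last k)) =
        ((c.1 0).map (QuotientGroup.mk' (c.1 0).normalCore)).index := by
      rw [hl, Subgroup.relIndex_top_right, ← Subgroup.index_comap_of_surjective _
        (QuotientGroup.mk'_surjective (c.1 0).normalCore), c.comap_map_mk'_normalCore 0]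
    exact hindex ▸ c.2

lemma exists_ofLChain_preimage_eq (c : LChain n ⦋k⦌ G) (hc : StrictMono c.1)
    (hl : c.1 (Fin.last k) = ⊤) : ∃ ψ, (ofLChain c hc hl).preimage ψ = LClass.mk c :=
  ⟨OutCat.mkHom ⟨QuotientGroup.mk' (c.1 0).normalCore, QuotientGroup.mk'_surjective _⟩,
    congrArg LClass.mk (Subtype.ext (OrderHom.ext _ _ (funext c.comap_map_mk'_normalCore)))⟩

lemma comap_ofEquiv_toLChain {c d : SimpleChain n k} (e : c.top ≃* d.top)
    (he : ∀ i, (c.chain i).map e.toMonoidHom = d.chain i) :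
    LChain.comap (OutCat.ofEquiv e) d.toLChain = c.toLChain :=
  Subtype.ext <| OrderHom.ext _ _ <| funext fun i =>
    (congrArg (Subgroup.comap e.toMonoidHom) (he i).symm).trans
      (Subgroup.comap_map_eq_self_of_injective e.injective _)

end SimpleChain

namespace SimpleChainClass

variable {n : ℕ∞} {k : ℕ} {G : OutCat}

lemma exists_rep_preimage_eq {y : LClass n ⦋k⦌ G} (hy : y ∉ nullSimplices n k (op G)) :
    ∃ (x : SimpleChainClass n k) (ψ : G ⟶ x.rep.top), x.rep.preimage ψ = y := by
  obtain ⟨c, rfl⟩ := LClass.mk_surjective y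
  rw [LClass.mk_mem_nullSimplices_iff, not_not] at hy
  obtain ⟨ψ, hψ⟩ := SimpleChain.exists_ofLChain_preimage_eq c hy.1 hy.2
  obtain ⟨e, he⟩ := (SimpleChain.isoSetoid n k).symm
    (Quotient.mk_out (s := SimpleChain.isoSetoid n k) (SimpleChain.ofLChain c hy.1 hy.2))
  refine ⟨_, ψ ≫ OutCat.mkHom (OutCat.ofEquiv e), Eq.trans ?_ hψ⟩
  refine (SimpleChain.comap_preimage _ _ _).symm.trans (congrArg (LClass.comap ψ) ?_)
  exact congrArg LClass.mk (SimpleChain.comap_ofEquiv_toLChain e he)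

lemma exists_outGroup_of_rep_preimage_eq {x : SimpleChainClass n k} {ψ φ : G ⟶ x.rep.top}
    (h : x.rep.preimage ψ = x.rep.preimage φ) : ∃ α ∈ x.rep.outGroup, ψ ≫ α.hom = φ := by
  obtain ⟨e, he, hψ⟩ := SimpleChain.exists_equiv_of_preimage_eq h
  refine ⟨OutCat.isoOfEquiv e, ⟨e, rfl, 1, fun i => ?_⟩, hψ⟩
  rw [he, map_one]
  exact (Subgroup.map_id _).symm

lemma eq_of_rep_preimage_eq {x x' : SimpleChainClass n k} {ψ : G ⟶ x.rep.top}
    {φ : G ⟶ x'.rep.top} (h : x.rep.preimage ψ = x'.rep.preimage φ) : x = x' := by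
  obtain ⟨e, he, -⟩ := SimpleChain.exists_equiv_of_preimage_eq h
  exact Quotient.out_equiv_out.1 ⟨e, he⟩

end SimpleChainClass

/-! ### The direct sum decomposition -/

namespace CL

variable {n : ℕ∞} {k : ℕ} {G : OutCatᵒᵖ}

/-- The class of a simplex of `L(G)_n / G` in `(𝒞L̃_n)_k(G)`. -/
def mk (y : LClass n ⦋k⦌ G.unop) : ((CL n).X k).obj G :=
  (nullSub n k).proj.app G (ModuleCat.freeMk y)

lemma mk_eq_zero {y : LClass n ⦋k⦌ G.unop} (hy : y ∈ nullSimplices n k G) : CL.mk y = 0 :=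
  (Submodule.Quotient.mk_eq_zero _).2 (Submodule.subset_span ⟨y, hy, rfl⟩)

lemma map_mk {K : OutCatᵒᵖ} (f : G ⟶ K) (y : LClass n ⦋k⦌ G.unop) :
    ((CL n).X k).map f (CL.mk y) = CL.mk (LClass.comap f.unop y) :=
  (ConcreteCategory.congr_hom ((nullSub n k).proj.naturality f) _).symm.trans
    (congrArg ((nullSub n k).proj.app K) (ModuleCat.free_map_apply _ _))

section Lift

variable {M : Type*} [AddCommGroup M] [Module ℚ M]

lemma linearMap_ext {f g : ((CL n).X k).obj G →ₗ[ℚ] M}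
    (h : ∀ y : LClass n ⦋k⦌ G.unop, f (CL.mk y) = g (CL.mk y)) : f = g :=
  Submodule.linearMap_qext _ (Finsupp.lhom_ext' fun y => LinearMap.ext_ring (h y))

/-- The linear map out of `(𝒞L̃_n)_k(G)` with prescribed values on the simplices. -/
def lift (φ : LClass n ⦋k⦌ G.unop → M) (h : ∀ y ∈ nullSimplices n k G, φ y = 0) :
    ((CL n).X k).obj G →ₗ[ℚ] M :=
  Submodule.liftQ ((nullSub n k).carrier G) (Finsupp.linearCombination ℚ φ) <| by
    refine Submodule.span_le.2 ?_
    rintro _ ⟨y, hy, rfl⟩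
    exact (Finsupp.linearCombination_single ℚ 1 y).trans ((one_smul _ _).trans (h y hy))

lemma lift_mk (φ : LClass n ⦋k⦌ G.unop → M) (h : ∀ y ∈ nullSimplices n k G, φ y = 0)
    (y : LClass n ⦋k⦌ G.unop) : lift φ h (CL.mk y) = φ y :=
  (Finsupp.linearCombination_single ℚ 1 y).trans (one_smul _ _)

end Lift

variable {Q : OutMod}

lemma hom_ext {f g : (CL n).X k ⟶ Q}
    (h : ∀ (G : OutCatᵒᵖ) (y : LClass n ⦋k⦌ G.unop), f.app G (CL.mk y) = g.app G (CL.mk y)) :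
    f = g :=
  NatTrans.ext (funext fun G => ModuleCat.hom_ext (linearMap_ext (h G)))

/-- The map of `ℚ[Out^op]`-modules out of `(𝒞L̃_n)_k` with prescribed values on the simplices. -/
def desc (φ : ∀ G : OutCatᵒᵖ, LClass n ⦋k⦌ G.unop → Q.obj G)
    (hnull : ∀ G, ∀ y ∈ nullSimplices n k G, φ G y = 0)
    (hcomap : ∀ (G K : OutCatᵒᵖ) (f : G ⟶ K) (y : LClass n ⦋k⦌ G.unop),
      φ K (LClass.comap f.unop y) = Q.map f (φ G y)) : (CL n).X k ⟶ Q where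
  app G := ModuleCat.ofHom (lift (φ G) (hnull G))
  naturality G K f := by
    refine ModuleCat.hom_ext (linearMap_ext fun y => ?_)
    refine (congrArg (lift (φ K) (hnull K)) (map_mk f y)).trans ?_
    refine (lift_mk (φ K) (hnull K) _).trans ((hcomap G K f y).trans ?_)
    exact congrArg (Q.map f) (lift_mk (φ G) (hnull G) y).symm

lemma desc_mk (φ : ∀ G : OutCatᵒᵖ, LClass n ⦋k⦌ G.unop → Q.obj G)
    (hnull : ∀ G, ∀ y ∈ nullSimplices n k G, φ G y = 0)
    (hcomap : ∀ (G K : OutCatᵒᵖ) (f : G ⟶ K) (y : LClass n ⦋k⦌ G.unop),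
      φ K (LClass.comap f.unop y) = Q.map f (φ G y)) (y : LClass n ⦋k⦌ G.unop) :
    (desc φ hnull hcomap).app G (CL.mk y) = φ G y :=
  lift_mk (φ G) (hnull G) y

end CL

namespace SimpleChain

variable {n : ℕ∞} {k : ℕ} {G : OutCatᵒᵖ}

/-- The class of a surjection in the orbit module. -/
def orbitMk (c : SimpleChain n k) (ψ : G.unop ⟶ c.top) : c.orbitModule.obj G :=
  c.orbitSub.proj.app G (ModuleCat.freeMk ψ)

lemma map_orbitMk (c : SimpleChain n k) {K : OutCatᵒᵖ} (f : G ⟶ K) (ψ : G.unop ⟶ c.top) :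
    c.orbitModule.map f (c.orbitMk ψ) = c.orbitMk (f.unop ≫ ψ) :=
  (ConcreteCategory.congr_hom (c.orbitSub.proj.naturality f) (ModuleCat.freeMk ψ)).symm.trans
    (congrArg (c.orbitSub.proj.app K) (ModuleCat.free_map_apply _ _))

lemma orbitMk_comp (c : SimpleChain n k) (ψ : G.unop ⟶ c.top) {α : Aut c.top}
    (hα : α ∈ c.outGroup) : c.orbitMk (ψ ≫ α.hom) = c.orbitMk ψ :=
  (Submodule.Quotient.eq _).2 (Submodule.subset_span ⟨α, hα, ψ, rfl⟩)

lemma orbitModule_hom_ext {c : SimpleChain n k} {Q : OutMod} {f g : c.orbitModule ⟶ Q}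
    (h : ∀ (G : OutCatᵒᵖ) (ψ : G.unop ⟶ c.top),
      f.app G (c.orbitMk ψ) = g.app G (c.orbitMk ψ)) : f = g :=
  OutMod.Sub.hom_ext c.orbitSub (free_functor_hom_ext (F := yoneda.obj c.top) h)

lemma orbitMap_orbitMk (c : SimpleChain n k) (ψ : G.unop ⟶ c.top) :
    c.orbitMap.app G (c.orbitMk ψ) = CL.mk (c.preimage ψ) :=
  congrArg ((nullSub n k).proj.app G) (c.preimageMap_freeMk G ψ)

end SimpleChain

namespace SimpleChainClass

variable {n : ℕ∞} {k : ℕ} {G : OutCatᵒᵖ} {Q : OutMod}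
  (t : ∀ x : SimpleChainClass n k, x.rep.orbitModule ⟶ Q)

lemma app_orbitMk_eq_of_preimage_eq {x x' : SimpleChainClass n k} {ψ : G.unop ⟶ x.rep.top}
    {φ : G.unop ⟶ x'.rep.top} (h : x.rep.preimage ψ = x'.rep.preimage φ) :
    (t x).app G (x.rep.orbitMk ψ) = (t x').app G (x'.rep.orbitMk φ) := by
  obtain rfl := eq_of_rep_preimage_eq h
  obtain ⟨α, hα, rfl⟩ := exists_outGroup_of_rep_preimage_eq h
  exact congrArg ((t x).app G) (x.rep.orbitMk_comp ψ hα).symm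

lemma exists_simplexValue (y : LClass n ⦋k⦌ G.unop) :
    ∃ q : Q.obj G, (y ∈ nullSimplices n k G → q = 0) ∧
      ∀ x ψ, x.rep.preimage ψ = y → (t x).app G (x.rep.orbitMk ψ) = q := by
  by_cases hy : y ∈ nullSimplices n k G
  · refine ⟨0, fun _ => rfl, ?_⟩
    rintro x ψ rfl
    exact (x.rep.preimage_notMem_nullSimplices ψ hy).elim
  · obtain ⟨x, ψ, rfl⟩ := exists_rep_preimage_eq hy
    exact ⟨_, fun h => (hy h).elim, fun x' φ h => app_orbitMk_eq_of_preimage_eq t h⟩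

/-- The value on a simplex `[ψ⁻¹(H₀) < ⋯ < ψ⁻¹(H_k)]` of the map out of `(𝒞L̃_n)_k` given by a
family of maps out of the orbit modules, namely the value of the family at the class of `ψ`; null
simplices have value `0`. -/
def simplexValue (G : OutCatᵒᵖ) (y : LClass n ⦋k⦌ G.unop) : Q.obj G :=
  (exists_simplexValue t y).choose

lemma simplexValue_eq_zero (y : LClass n ⦋k⦌ G.unop) (hy : y ∈ nullSimplices n k G) :
    simplexValue t G y = 0 :=
  (exists_simplexValue t y).choose_spec.1 hy

lemma simplexValue_preimage (x : SimpleChainClass n k) (ψ : G.unop ⟶ x.rep.top) :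
    simplexValue t G (x.rep.preimage ψ) = (t x).app G (x.rep.orbitMk ψ) :=
  ((exists_simplexValue t (x.rep.preimage ψ)).choose_spec.2 x ψ rfl).symm

lemma simplexValue_comap (G K : OutCatᵒᵖ) (f : G ⟶ K) (y : LClass n ⦋k⦌ G.unop) :
    simplexValue t K (LClass.comap f.unop y) = Q.map f (simplexValue t G y) := by
  by_cases hy : y ∈ nullSimplices n k G
  · rw [simplexValue_eq_zero t _ ((LClass.comap_mem_nullSimplices_iff _ _).2 hy),
      simplexValue_eq_zero t _ hy, map_zero]
  · obtain ⟨x, ψ, rfl⟩ := exists_rep_preimage_eq hy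
    rw [SimpleChain.comap_preimage, simplexValue_preimage, simplexValue_preimage,
      ← SimpleChain.map_orbitMk]
    exact ConcreteCategory.congr_hom ((t x).naturality f) _

end SimpleChainClass

lemma CL.hom_ext_of_orbitMap {n : ℕ∞} {k : ℕ} {Q : OutMod} {f g : (CL n).X k ⟶ Q}
    (h : ∀ x : SimpleChainClass n k, x.rep.orbitMap ≫ f = x.rep.orbitMap ≫ g) : f = g := by
  refine CL.hom_ext fun G y => ?_
  by_cases hy : y ∈ nullSimplices n k G
  · rw [CL.mk_eq_zero hy, map_zero, map_zero]
  · obtain ⟨x, ψ, rfl⟩ := SimpleChainClass.exists_rep_preimage_eq hy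
    rw [← SimpleChain.orbitMap_orbitMk]
    exact ConcreteCategory.congr_hom (NatTrans.congr_app (h x) G) (x.rep.orbitMk ψ)

/-- Part (2): `(𝒞L̃_n)_k` is the direct sum of the orbit modules. -/
def isColimitOrbitCofan (n : ℕ∞) (k : ℕ) : IsColimit (orbitCofan n k) :=
  let desc (s : Cofan fun x : SimpleChainClass n k => x.rep.orbitModule) : (CL n).X k ⟶ s.pt :=
    CL.desc (SimpleChainClass.simplexValue s.inj)
      (fun _ => SimpleChainClass.simplexValue_eq_zero s.inj)
      (SimpleChainClass.simplexValue_comap s.inj)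
  have fac (s) (x : SimpleChainClass n k) : x.rep.orbitMap ≫ desc s = s.inj x :=
    SimpleChain.orbitModule_hom_ext fun G ψ =>
      (congrArg ((desc s).app G) (x.rep.orbitMap_orbitMk ψ)).trans
        ((CL.desc_mk _ _ _ _).trans (SimpleChainClass.simplexValue_preimage s.inj x ψ))
  Cofan.IsColimit.mk _ desc fac fun s _ hm =>
    CL.hom_ext_of_orbitMap fun x => (hm x).trans (fac s x).symm

lemma projective_CL_X (n : ℕ∞) (k : ℕ) : Projective ((CL n).X k) :=
  projective_of_isColimit_cofan _ (isColimitOrbitCofan n k) fun x => x.rep.projective_orbitModule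

/-! ### The contraction -/

namespace LChain

variable {k : ℕ} {G : OutCat}

/-- The cone on a chain: the trivial subgroup is put at the bottom. -/
def cone (c : LChain ⊤ ⦋k⦌ G) : LChain ⊤ ⦋k + 1⦌ G where
  val :=
    { toFun := Fin.cons (α := fun _ => Subgroup G) ⊥ c.1
      monotone' := by
        refine (Fin.monotone_iff_le_succ (n := k + 1)).2 (Fin.cases bot_le fun i => ?_)
        exact c.1.monotone (Fin.castSucc_le_succ i) }
  property := le_top

/-- The `0`-simplex of `L(G)` given by the trivial subgroup. -/
def bot : LChain ⊤ ⦋0⦌ G :=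
  ⟨OrderHom.const _ ⊥, le_top⟩

lemma pull_δ_zero_cone (c : LChain ⊤ ⦋k⦌ G) : pull (SimplexCategory.δ 0) c.cone = c := rfl

lemma pull_δ_succ_cone (c : LChain ⊤ ⦋k + 1⦌ G) (i : Fin (k + 2)) :
    pull (SimplexCategory.δ i.succ) c.cone = (pull (SimplexCategory.δ i) c).cone := by
  refine Subtype.ext (OrderHom.ext _ _ (funext fun j => ?_))
  change c.cone.1 (i.succ.succAbove j) = _
  induction j using Fin.cases with
  | zero => rw [Fin.succ_succAbove_zero]; rfl
  | succ j => rw [Fin.succ_succAbove_succ]; rfl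

lemma pull_δ_one_cone (c : LChain ⊤ ⦋0⦌ G) : pull (SimplexCategory.δ 1) c.cone = bot :=
  Subtype.ext (OrderHom.ext _ _ (funext fun j => by rw [Subsingleton.elim (α := Fin 1) j 0]; rfl))

end LChain

namespace LClass

variable {k : ℕ} {G : OutCat}

/-- The cone on a conjugacy class of chains. -/
def cone : LClass ⊤ ⦋k⦌ G → LClass ⊤ ⦋k + 1⦌ G :=
  Quotient.map (sa := LChain.conjSetoid ⊤ ⦋k⦌ G) (sb := LChain.conjSetoid ⊤ ⦋k + 1⦌ G)
    LChain.cone fun _ _ ⟨g, h⟩ => ⟨g, Fin.cases (Subgroup.map_bot _).symm h⟩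

lemma cone_mem_nullSimplices {y : LClass ⊤ ⦋k⦌ G} (hy : y ∈ nullSimplices ⊤ k (op G)) :
    cone y ∈ nullSimplices ⊤ (k + 1) (op G) := by
  obtain ⟨c, rfl⟩ := mk_surjective y
  refine (mk_mem_nullSimplices_iff c.cone).2 fun ⟨h, hl⟩ => ?_
  exact (mk_mem_nullSimplices_iff c).1 hy ⟨h.comp Fin.strictMono_succ, hl⟩

lemma pull_δ_zero_cone (y : LClass ⊤ ⦋k⦌ G) : pull (SimplexCategory.δ 0) (cone y) = y := by
  obtain ⟨c, rfl⟩ := mk_surjective y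
  exact congrArg mk c.pull_δ_zero_cone

lemma pull_δ_succ_cone (y : LClass ⊤ ⦋k + 1⦌ G) (i : Fin (k + 2)) :
    pull (SimplexCategory.δ i.succ) (cone y) = cone (pull (SimplexCategory.δ i) y) := by
  obtain ⟨c, rfl⟩ := mk_surjective y
  exact congrArg mk (c.pull_δ_succ_cone i)

lemma pull_δ_one_cone (y : LClass ⊤ ⦋0⦌ G) :
    pull (SimplexCategory.δ 1) (cone y) = mk LChain.bot := by
  obtain ⟨c, rfl⟩ := mk_surjective y
  exact congrArg mk c.pull_δ_one_cone

lemma mk_mem_nullSimplices_zero_iff {n : ℕ∞} (c : LChain n ⦋0⦌ G) :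
    mk c ∈ nullSimplices n 0 (op G) ↔ c.1 (Fin.last 0) ≠ ⊤ := by
  rw [mk_mem_nullSimplices_iff, and_iff_right (Subsingleton.strictMono (α := Fin 1) _)]

lemma nontrivial_of_mem_nullSimplices_zero {n : ℕ∞} {y : LClass n ⦋0⦌ G}
    (hy : y ∈ nullSimplices n 0 (op G)) : Nontrivial G := by
  obtain ⟨c, rfl⟩ := mk_surjective y
  exact Subgroup.nontrivial_iff.1 ⟨_, _, (mk_mem_nullSimplices_zero_iff c).1 hy⟩

end LClass

namespace OutMod

/-- The canonical generator of `atTrivial`, which is zero at the nontrivial groups. -/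
def atTrivialOne (G : OutCatᵒᵖ) : atTrivial.obj G :=
  atTrivialSub.proj.app G (1 : ℚ)

lemma atTrivialOne_eq_zero (G : OutCatᵒᵖ) [hG : Nontrivial G.unop] : atTrivialOne G = 0 :=
  (Submodule.Quotient.mk_eq_zero _).2 (Submodule.mem_iSup_of_mem hG Submodule.mem_top)

lemma exists_smul_atTrivialOne_eq {G : OutCatᵒᵖ} (z : atTrivial.obj G) :
    ∃ q : ℚ, q • atTrivialOne G = z := by
  obtain ⟨q, rfl⟩ := Submodule.mkQ_surjective _ z
  exact ⟨q, ((atTrivialSub.proj.app G).hom.map_smul q (1 : ℚ)).symm.trans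
    (congrArg (atTrivialSub.proj.app G) (mul_one (M := ℚ) q))⟩

/-- The linear map out of `atTrivial` at `G` sending the generator to a vector which vanishes if `G`
is nontrivial. -/
def atTrivialLift {G : OutCatᵒᵖ} {M : Type*} [AddCommGroup M] [Module ℚ M] (m : M)
    (h : Nontrivial G.unop → m = 0) : atTrivial.obj G →ₗ[ℚ] M :=
  Submodule.liftQ (atTrivialSub.carrier G) (LinearMap.toSpanSingleton ℚ M m) <|
    iSup_le fun hG => by rw [h hG, LinearMap.toSpanSingleton_zero, LinearMap.ker_zero]

lemma atTrivialLift_one {G : OutCatᵒᵖ} {M : Type*} [AddCommGroup M] [Module ℚ M] (m : M)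
    (h : Nontrivial G.unop → m = 0) : atTrivialLift m h (atTrivialOne G) = m :=
  one_smul ℚ m

end OutMod

namespace CL

variable {k : ℕ} {G : OutCatᵒᵖ}

lemma d_mk {n : ℕ∞} (y : LClass n ⦋k + 1⦌ G.unop) :
    ((CL n).d (k + 1) k).app G (CL.mk y) = ∑ i : Fin (k + 2), (-1 : ℤ) ^ (i : ℕ) •
      (CL.mk (LClass.pull (SimplexCategory.δ i) y) : ((CL n).X k).obj G) := by
  have hd : (CL n).d (k + 1) k = (nullSub n (k + 1)).map (nullSub n k)
      (AlgebraicTopology.AlternatingFaceMapComplex.objD (latticeModule n) k) (null_face n k) :=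
    ChainComplex.of_d (fun k => (nullSub n k).quotient) (fun k => (nullSub n (k + 1)).map
      (nullSub n k) (AlgebraicTopology.AlternatingFaceMapComplex.objD (latticeModule n) k)
      (null_face n k)) k
  rw [hd]
  refine (congrArg ((nullSub n k).proj.app G) (objD_freeMk n k G y)).trans ?_
  refine (map_sum ((nullSub n k).proj.app G).hom _ _).trans (Finset.sum_congr rfl fun i _ => ?_)
  exact map_zsmul ((nullSub n k).proj.app G).hom _ _

lemma d_one_zero_mk {n : ℕ∞} (y : LClass n ⦋1⦌ G.unop) :
    ((CL n).d 1 0).app G (CL.mk y) =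
      (CL.mk (LClass.pull (SimplexCategory.δ 0) y) : ((CL n).X 0).obj G) -
        CL.mk (LClass.pull (SimplexCategory.δ 1) y) := by
  rw [d_mk, Fin.sum_univ_two, Fin.val_zero, Fin.val_one, pow_zero, pow_one, one_smul, neg_one_smul,
    sub_eq_add_neg]

/-- The contracting homotopy of `𝒞L̃(G)` given by cones. It is not natural in `G`, since the
preimage of the trivial subgroup is not trivial. -/
def contraction (k : ℕ) (G : OutCatᵒᵖ) : ((CL ⊤).X k).obj G →ₗ[ℚ] ((CL ⊤).X (k + 1)).obj G :=
  lift (fun y => CL.mk (LClass.cone y)) fun _ hy => mk_eq_zero (LClass.cone_mem_nullSimplices hy)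

lemma contraction_mk (y : LClass ⊤ ⦋k⦌ G.unop) :
    contraction k G (CL.mk y) = CL.mk (LClass.cone y) :=
  lift_mk _ _ y

lemma d_comp_contraction_add :
    (((CL ⊤).d (k + 2) (k + 1)).app G).hom ∘ₗ contraction (k + 1) G +
      contraction k G ∘ₗ (((CL ⊤).d (k + 1) k).app G).hom = LinearMap.id := by
  refine linearMap_ext fun y => ?_
  change ((CL ⊤).d (k + 2) (k + 1)).app G (contraction (k + 1) G (CL.mk y)) +
    contraction k G (((CL ⊤).d (k + 1) k).app G (CL.mk y)) = CL.mk y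
  rw [contraction_mk, d_mk, d_mk, map_sum, Fin.sum_univ_succ, LClass.pull_δ_zero_cone]
  simp only [map_zsmul, contraction_mk, LClass.pull_δ_succ_cone, Fin.val_zero, pow_zero,
    one_smul, Fin.val_succ, pow_succ, mul_neg, mul_one, neg_smul, Finset.sum_neg_distrib]
  exact neg_add_cancel_right _ _

/-- The augmentation of `𝒞L̃`, which takes every `0`-simplex to the generator of `atTrivial`. -/
def augmentation : (CL ⊤).X 0 ⟶ OutMod.atTrivial :=
  desc (fun G _ => OutMod.atTrivialOne G)
    (fun G _ hy =>
      have := LClass.nontrivial_of_mem_nullSimplices_zero hy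
      OutMod.atTrivialOne_eq_zero G)
    fun _ _ f _ => ConcreteCategory.congr_hom (OutMod.atTrivialSub.proj.naturality f) (1 : ℚ)

lemma augmentation_mk (y : LClass ⊤ ⦋0⦌ G.unop) :
    augmentation.app G (CL.mk y) = OutMod.atTrivialOne G :=
  desc_mk _ _ _ y

lemma augmentation_app_surjective (G : OutCatᵒᵖ) : Function.Surjective (augmentation.app G) := by
  intro z
  obtain ⟨q, rfl⟩ := OutMod.exists_smul_atTrivialOne_eq z
  exact ⟨q • CL.mk (LClass.mk LChain.bot), ((augmentation.app G).hom.map_smul q _).trans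
    (congrArg (q • ·) (augmentation_mk _))⟩

instance : Epi augmentation :=
  have (G : OutCatᵒᵖ) : Epi (augmentation.app G) :=
    (ModuleCat.epi_iff_surjective _).2 (augmentation_app_surjective G)
  NatTrans.epi_of_epi_app _

lemma d_comp_augmentation : (CL ⊤).d 1 0 ≫ augmentation = 0 := by
  refine hom_ext fun G y => (congrArg (augmentation.app G) (d_one_zero_mk y)).trans ?_
  rw [map_sub, augmentation_mk, augmentation_mk, sub_self]
  rfl

/-- The section of the augmentation at `G` given by the trivial subgroup. It is not natural in
`G`. -/
def augmentationSection (G : OutCatᵒᵖ) : OutMod.atTrivial.obj G →ₗ[ℚ] ((CL ⊤).X 0).obj G :=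
  OutMod.atTrivialLift (CL.mk (LClass.mk LChain.bot)) fun _ =>
    mk_eq_zero ((LClass.mk_mem_nullSimplices_zero_iff _).2 bot_ne_top)

lemma d_comp_contraction_zero_add :
    (((CL ⊤).d 1 0).app G).hom ∘ₗ contraction 0 G +
      augmentationSection G ∘ₗ (augmentation.app G).hom = LinearMap.id := by
  refine linearMap_ext fun y => ?_
  change ((CL ⊤).d 1 0).app G (contraction 0 G (CL.mk y)) +
    augmentationSection G (augmentation.app G (CL.mk y)) = CL.mk y
  rw [contraction_mk, d_one_zero_mk, augmentation_mk, LClass.pull_δ_zero_cone,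
    LClass.pull_δ_one_cone, augmentationSection, OutMod.atTrivialLift_one, sub_add_cancel]

lemma exact_augmentation : (ShortComplex.mk _ _ d_comp_augmentation).Exact :=
  exact_of_forall_exact_app _ fun G =>
    exact_of_comp_add_comp_eq_id _ (contraction 0 G) (augmentationSection G)
      d_comp_contraction_zero_add

lemma exactAt_succ (k : ℕ) : (CL ⊤).ExactAt (k + 1) := by
  rw [HomologicalComplex.exactAt_iff' _ (k + 2) (k + 1) k (by simp) (by simp)]
  exact exact_of_forall_exact_app _ fun G =>
    exact_of_comp_add_comp_eq_id _ (contraction (k + 1) G) (contraction k G)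
      d_comp_contraction_add

/-- The complex `𝒞L̃` as a projective resolution of `atTrivial`. -/
def resolution : ProjectiveResolution OutMod.atTrivial where
  complex := CL ⊤
  projective := projective_CL_X ⊤
  π := ((CL ⊤).toSingle₀Equiv _).symm ⟨augmentation, d_comp_augmentation⟩
  quasiIso := quasiIso_toSingle₀Equiv_symm _ _ _ exact_augmentation exactAt_succ

end CL

end

theorem mainTheorem8 :
    (∀ (n : ℕ∞) (k : ℕ), Projective ((CL n).X k)) ∧
    (∀ (n : ℕ∞) (k : ℕ), Nonempty (IsColimit (orbitCofan n k))) ∧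
    (∃ P : ProjectiveResolution OutMod.atTrivial, P.complex = CL ⊤) :=
  ⟨projective_CL_X, fun n k => ⟨isColimitOrbitCofan n k⟩, CL.resolution, rfl⟩
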